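/- There are absolute constants $C,K>0$ such that the following holds. Let $n,m\ge 1$, let $A\in\mathbb{R}^{n\times m}$ have rank $r$, and let $A$ be $(\mu_1,\mu_2)$-incoherent: if $A=U\Sigma V^\top$ is a singular value decomposition with $U\in\mathbb{R}^{n\times r}$ and $V\in\mathbb{R}^{m\times r}$, then $$\max_{i\in[n]}\|U_{i,\cdot}\|_2^2\le \frac{\mu_1 r}{n},\qquad \max_{j\in[m]}\|V_{j,\cdot}\|_2^2\le \frac{\mu_2 r}{m}.$$ Let $p\in(0,1]$ and let $\tilde{\mathcal W}$ be a random subset of the wedge set $\mathcal W=\{(i,\ell,j):1\le i\le j\le n,\ \ell\in[m]\}$ which contains each element of $\mathcal W$ independently with probability $p$. Put $Z_{i\ell j}=p^{-1}A_{i\ell}A_{j\ell}\,\mathbf 1_{\{(i,\ell,j)\in\tilde{\mathcal W}\}}\,e_ie_j^\top$ (with $e_1,\dots,e_n$ the standard basis of $\mathbb{R}^n$) and $$Z=\sum_{1\le i<j\le n,\ \ell\in[m]}\bigl(Z_{i\ell j}+Z_{i\ell j}^\top\bigr)+\sum_{i\in[n],\ \ell\in[m]}Z_{i\ell i}.$$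 Then for every real $a>2$, with probability at least $1-Kn^{-a}$, $$\|Z-AA^\top\|\le C\left(\sqrt{\frac{a\mu_1\mu_2r^2\log n}{pmn}}+\frac{a\mu_1\mu_2r^2\log n}{pmn}\right)\|A\|^2,$$ where $\|\cdot\|$ denotes the spectral (operator) norm. -/

import Mathlib

open MeasureTheory ProbabilityTheory
open scoped Matrix Matrix.Norms.L2Operator

/-- `A = U Σ Vᵀ` is a (compact) singular value decomposition of `A` with `r` singular values:
`U` and `V` have orthonormal columns and `Σ = diag(σ)` has positive, non-increasing entries. -/
structure IsCompactSVD {n m r : ℕ} (A : Matrix (Fin n) (Fin m) ℝ)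
    (U : Matrix (Fin n) (Fin r) ℝ) (σ : Fin r → ℝ) (V : Matrix (Fin m) (Fin r) ℝ) : Prop where
  left_orthonormal : Uᵀ * U = 1
  right_orthonormal : Vᵀ * V = 1
  sigma_pos : ∀ k, 0 < σ k
  sigma_antitone : Antitone σ
  eq_mul : A = U * Matrix.diagonal σ * Vᵀ

/-- `(μ₁, μ₂)`-incoherence of a matrix `A` of rank `r`: in a singular value decomposition
`A = U Σ Vᵀ` with `U ∈ ℝ^{n × r}`, `V ∈ ℝ^{m × r}`, every row of `U` has squared Euclidean norm at
most `μ₁ r / n` and every row of `V` has squared Euclidean norm at most `μ₂ r / m`. (The row norms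
are the same for every choice of the decomposition.) -/
def IsIncoherent {n m : ℕ} (μ₁ μ₂ : ℝ) (A : Matrix (Fin n) (Fin m) ℝ) : Prop :=
  ∃ (U : Matrix (Fin n) (Fin A.rank) ℝ) (σ : Fin A.rank → ℝ) (V : Matrix (Fin m) (Fin A.rank) ℝ),
    IsCompactSVD A U σ V ∧
    (∀ i, ‖WithLp.toLp 2 (U i)‖ ^ 2 ≤ μ₁ * A.rank / n) ∧
    (∀ j, ‖WithLp.toLp 2 (V j)‖ ^ 2 ≤ μ₂ * A.rank / m)

/-- The set of wedges `(i, ℓ, j)` with `i ≤ j`. -/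
def wedgeSet (n m : ℕ) : Set (Fin n × Fin m × Fin n) := {t | t.1 ≤ t.2.2}

/-- `W` is a random subset of the wedge set, on the probability space `(Ω, P)`, that contains each
wedge independently with probability `p`. -/
structure IsWedgeSample {n m : ℕ} {Ω : Type*} [MeasurableSpace Ω] (P : Measure Ω) (p : ℝ)
    (W : Ω → Set (Fin n × Fin m × Fin n)) : Prop where
  subset : ∀ ω, W ω ⊆ wedgeSet n m
  measurableSet_mem : ∀ t ∈ wedgeSet n m, MeasurableSet {ω | t ∈ W ω}
  prob_mem : ∀ t ∈ wedgeSet n m, P.real {ω | t ∈ W ω} = p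
  indep : iIndepSet (fun t : wedgeSet n m => {ω | (t : Fin n × Fin m × Fin n) ∈ W ω}) P

open Classical in
/-- The matrix `Z_{iℓj} = p⁻¹ A_{iℓ} A_{jℓ} 1{(i,ℓ,j) ∈ W} e_i e_jᵀ`. -/
noncomputable def wedgeTerm {n m : ℕ} (p : ℝ) (A : Matrix (Fin n) (Fin m) ℝ)
    (W : Set (Fin n × Fin m × Fin n)) (i : Fin n) (l : Fin m) (j : Fin n) :
    Matrix (Fin n) (Fin n) ℝ :=
  Matrix.single i j (p⁻¹ * A i l * A j l * (if (i, l, j) ∈ W then 1 else 0))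

/-- The wedge estimator
`Z = ∑_{i < j, ℓ} (Z_{iℓj} + Z_{iℓj}ᵀ) + ∑_{i, ℓ} Z_{iℓi}` of `A Aᵀ`. -/
noncomputable def wedgeEstimator {n m : ℕ} (p : ℝ) (A : Matrix (Fin n) (Fin m) ℝ)
    (W : Set (Fin n × Fin m × Fin n)) : Matrix (Fin n) (Fin n) ℝ :=
  (∑ i, ∑ j ∈ Finset.Ioi i, ∑ l, (wedgeTerm p A W i l j + (wedgeTerm p A W i l j)ᵀ)) +
    ∑ i, ∑ l, wedgeTerm p A W i l i

/-! ### Trace inequalities for symmetric matrices. -/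

section TraceInequalities

variable {ι : Type*} [Fintype ι] [DecidableEq ι]

/-! The error Z - AAᵀ is S = ∑ (ξ_k - 1) H_k, with one symmetric matrix H_k per wedge and
independent ξ_k = p⁻¹ 1{k ∈ T} of mean 1. Its spectral norm is controlled by Markov's inequality for
an even trace moment of order about 2a log n.

To bound E tr S^(2q+2), write one factor S as its sum. By `bernoulliExp_centered`, the centered
coefficient ξ_k - 1 becomes a difference between forcing k into T and out of it. The two values of S
differ by p⁻¹ H_k, so `trace_sub_mul_pow_sub_pow_le` produces traces of H_k² against S^(2q). Every
H_k² is diagonal; summing over k leaves tr(D S^(2q)) with D a random diagonal matrix. The Young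
inequality `trace_diagonal_mul_even_pow_le` absorbs half of the moment into the left side and leaves
moments of the scalar sums D_i, which `bernoulliExp_pow_le` bounds by an exponential moment.

Incoherence enters only through two numbers: the largest entry of the H_k² (from entries of A) and
the largest diagonal entry of ∑ H_k² (from row and column norms of A). -/

/-- A real symmetric matrix is orthogonally diagonalizable. -/
theorem Matrix.IsSymm.exists_orthogonal_diagonalization {A : Matrix ι ι ℝ} (hA : A.IsSymm) :
    ∃ (U : Matrix ι ι ℝ) (d : ι → ℝ), Uᵀ * U = 1 ∧ U * Uᵀ = 1 ∧
      A = U * Matrix.diagonal d * Uᵀ := by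
  have hH : A.IsHermitian := by
    rw [Matrix.IsHermitian, Matrix.conjTranspose_eq_transpose_of_trivial]; exact hA
  have hst : ∀ M : Matrix ι ι ℝ, star M = Mᵀ := fun M => by
    rw [Matrix.star_eq_conjTranspose, Matrix.conjTranspose_eq_transpose_of_trivial]
  refine ⟨hH.eigenvectorUnitary, hH.eigenvalues, ?_, ?_, ?_⟩
  · rw [← hst]; exact Unitary.coe_star_mul_self _
  · rw [← hst]; exact Unitary.coe_mul_star_self _
  · have h := hH.spectral_theorem
    rw [Unitary.conjStarAlgAut_apply] at h
    rw [← hst]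
    exact h

theorem conj_diagonal_pow {U : Matrix ι ι ℝ} (hU : Uᵀ * U = 1) (hU' : U * Uᵀ = 1) (d : ι → ℝ)
    (k : ℕ) :
    (U * Matrix.diagonal d * Uᵀ) ^ k = U * Matrix.diagonal (fun i => d i ^ k) * Uᵀ := by
  induction k with
  | zero => simp [hU']
  | succ k ih =>
    rw [pow_succ, ih]
    calc U * Matrix.diagonal (fun i => d i ^ k) * Uᵀ * (U * Matrix.diagonal d * Uᵀ)
        = U * Matrix.diagonal (fun i => d i ^ k) * (Uᵀ * U) * Matrix.diagonal d * Uᵀ := by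
          simp only [Matrix.mul_assoc]
      _ = _ := by
          rw [hU, Matrix.mul_one, Matrix.mul_assoc U, Matrix.diagonal_mul_diagonal]
          simp only [pow_succ]

/-- The weights `(Uᵀ * V) i j ^ 2` are nonnegative, so trace inequalities for two noncommuting
symmetric matrices reduce to scalar inequalities between pairs of eigenvalues. -/
theorem trace_conj_diagonal_mul (U V : Matrix ι ι ℝ) (f g : ι → ℝ) :
    ((U * Matrix.diagonal f * Uᵀ) * (V * Matrix.diagonal g * Vᵀ)).trace =
      ∑ i, ∑ j, f i * g j * (Uᵀ * V) i j ^ 2 := by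
  have h : ((U * Matrix.diagonal f * Uᵀ) * (V * Matrix.diagonal g * Vᵀ)).trace =
      (Matrix.diagonal f * ((Uᵀ * V) * (Matrix.diagonal g * (Uᵀ * V)ᵀ))).trace := by
    rw [Matrix.mul_assoc U, Matrix.mul_assoc U, Matrix.trace_mul_comm]
    simp only [Matrix.mul_assoc, Matrix.transpose_mul, Matrix.transpose_transpose]
  rw [h, Matrix.trace]
  refine Finset.sum_congr rfl fun i _ => ?_
  rw [Matrix.diag_apply, Matrix.diagonal_mul, Matrix.mul_apply, Finset.mul_sum]
  refine Finset.sum_congr rfl fun j _ => ?_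
  rw [Matrix.diagonal_mul, Matrix.transpose_apply]
  ring

theorem abs_pow_mul_pow_le (x y : ℝ) {a b q : ℕ} (hab : a + b = 2 * q) :
    x ^ a * y ^ b ≤ x ^ (2 * q) + y ^ (2 * q) := by
  have key : |x| ^ a * |y| ^ b ≤ |x| ^ (2 * q) + |y| ^ (2 * q) := by
    rcases le_total |x| |y| with h | h
    · calc |x| ^ a * |y| ^ b ≤ |y| ^ a * |y| ^ b := by gcongr
        _ = |y| ^ (2 * q) := by rw [← pow_add, hab]
        _ ≤ _ := le_add_of_nonneg_left (by positivity)
    · calc |x| ^ a * |y| ^ b ≤ |x| ^ a * |x| ^ b := by gcongr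
        _ = |x| ^ (2 * q) := by rw [← pow_add, hab]
        _ ≤ _ := le_add_of_nonneg_right (by positivity)
  rw [(even_two_mul q).pow_abs, (even_two_mul q).pow_abs] at key
  refine le_trans (le_abs_self _) ?_
  rwa [abs_mul, abs_pow, abs_pow]

/-- Factor the difference of powers as a geometric sum: it has 2q + 1 terms, each a monomial of
degree 2q. -/
theorem sub_mul_pow_sub_pow_le (x y : ℝ) (q : ℕ) :
    (x - y) * (x ^ (2 * q + 1) - y ^ (2 * q + 1)) ≤
      (2 * q + 1) * ((x - y) ^ 2 * (x ^ (2 * q) + y ^ (2 * q))) := by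
  have hg : (∑ i ∈ Finset.range (2 * q + 1), x ^ i * y ^ (2 * q + 1 - 1 - i)) ≤
      (2 * q + 1) * (x ^ (2 * q) + y ^ (2 * q)) := by
    refine (Finset.sum_le_sum fun i hi => abs_pow_mul_pow_le x y (q := q) ?_).trans ?_
    · have := Finset.mem_range.1 hi; omega
    · simp [mul_add]
  rw [← Commute.mul_geom_sum₂ (Commute.all x y)]
  calc _ = (x - y) ^ 2 *
        (∑ i ∈ Finset.range (2 * q + 1), x ^ i * y ^ (2 * q + 1 - 1 - i)) := by ring
    _ ≤ (x - y) ^ 2 * ((2 * q + 1) * (x ^ (2 * q) + y ^ (2 * q))) := by gcongr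
    _ = _ := by ring

/-- The mean value trace inequality for odd powers of symmetric matrices. -/
theorem trace_sub_mul_pow_sub_pow_le {A B : Matrix ι ι ℝ} (hA : A.IsSymm) (hB : B.IsSymm)
    (q : ℕ) :
    ((A - B) * (A ^ (2 * q + 1) - B ^ (2 * q + 1))).trace ≤
      (2 * q + 1) * ((A - B) ^ 2 * (A ^ (2 * q) + B ^ (2 * q))).trace := by
  obtain ⟨U, f, hU, hU', rfl⟩ := hA.exists_orthogonal_diagonalization
  obtain ⟨V, g, hV, hV', rfl⟩ := hB.exists_orthogonal_diagonalization
  set A := U * Matrix.diagonal f * Uᵀ with hAdef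
  set B := V * Matrix.diagonal g * Vᵀ with hBdef
  have hab : ∀ a b : ℕ, (A ^ a * B ^ b).trace =
      ∑ i, ∑ j, f i ^ a * g j ^ b * (Uᵀ * V) i j ^ 2 := fun a b => by
    rw [hAdef, hBdef, conj_diagonal_pow hU hU', conj_diagonal_pow hV hV', trace_conj_diagonal_mul]
  have hs : ∀ M : Matrix ι ι ℝ, M ^ (2 * q + 2) = M * (M ^ (2 * q) * M) := fun M => by
    rw [← pow_succ, ← pow_succ']
  have hs' : ∀ M : Matrix ι ι ℝ, M ^ (2 * q + 2) = M * (M * M ^ (2 * q)) := fun M => by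
    rw [← pow_succ', ← pow_succ']
  have h1 : ((A - B) * (A ^ (2 * q + 1) - B ^ (2 * q + 1))).trace =
      ∑ i, ∑ j, (f i - g j) * (f i ^ (2 * q + 1) - g j ^ (2 * q + 1)) * (Uᵀ * V) i j ^ 2 := by
    have e : ((A - B) * (A ^ (2 * q + 1) - B ^ (2 * q + 1))).trace =
        (A ^ (2 * q + 2) * B ^ 0).trace - (A ^ 1 * B ^ (2 * q + 1)).trace
          - (A ^ (2 * q + 1) * B ^ 1).trace + (A ^ 0 * B ^ (2 * q + 2)).trace := by
      rw [Matrix.trace_mul_comm (A ^ (2 * q + 1)) (B ^ 1)]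
      simp only [← Matrix.trace_sub, ← Matrix.trace_add]
      rw [hs, hs]
      congr 1
      noncomm_ring
    rw [e, hab, hab, hab, hab]
    simp only [← Finset.sum_sub_distrib, ← Finset.sum_add_distrib]
    refine Finset.sum_congr rfl fun i _ => Finset.sum_congr rfl fun j _ => ?_
    ring
  have h2 : ((A - B) ^ 2 * (A ^ (2 * q) + B ^ (2 * q))).trace =
      ∑ i, ∑ j, (f i - g j) ^ 2 * (f i ^ (2 * q) + g j ^ (2 * q)) * (Uᵀ * V) i j ^ 2 := by
    -- Cyclicity of the trace brings every word of the expansion to the form A^a B^b, to which `hab`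
    -- applies.
    have c1 : (B * A * A ^ (2 * q)).trace = (A ^ (2 * q + 1) * B ^ 1).trace := by
      rw [Matrix.mul_assoc, Matrix.trace_mul_comm, ← pow_succ', pow_one]
    have c2 : (A * B * A ^ (2 * q)).trace = (A ^ (2 * q + 1) * B ^ 1).trace := by
      rw [Matrix.trace_mul_comm, ← Matrix.mul_assoc, ← pow_succ, pow_one]
    have c3 : (B * B * A ^ (2 * q)).trace = (A ^ (2 * q) * B ^ 2).trace := by
      rw [Matrix.trace_mul_comm, sq]
    have c4 : (B * A * B ^ (2 * q)).trace = (A ^ 1 * B ^ (2 * q + 1)).trace := by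
      rw [Matrix.mul_assoc, Matrix.trace_mul_comm, Matrix.mul_assoc, ← pow_succ, pow_one]
    have c5 : (A * B * B ^ (2 * q)).trace = (A ^ 1 * B ^ (2 * q + 1)).trace := by
      rw [Matrix.mul_assoc, ← pow_succ', pow_one]
    have e : ((A - B) ^ 2 * (A ^ (2 * q) + B ^ (2 * q))).trace =
        (A ^ (2 * q + 2) * B ^ 0).trace - (B * A * A ^ (2 * q)).trace
          - (A * B * A ^ (2 * q)).trace + (B * B * A ^ (2 * q)).trace
          + (A ^ 2 * B ^ (2 * q)).trace - (B * A * B ^ (2 * q)).trace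
          - (A * B * B ^ (2 * q)).trace + (A ^ 0 * B ^ (2 * q + 2)).trace := by
      simp only [← Matrix.trace_sub, ← Matrix.trace_add]
      rw [hs', hs']
      congr 1
      noncomm_ring
    rw [e, c1, c2, c3, c4, c5, hab, hab, hab, hab, hab, hab]
    simp only [← Finset.sum_sub_distrib, ← Finset.sum_add_distrib]
    refine Finset.sum_congr rfl fun i _ => Finset.sum_congr rfl fun j _ => ?_
    ring
  rw [h1, h2]
  simp only [Finset.mul_sum]
  refine Finset.sum_le_sum fun i _ => Finset.sum_le_sum fun j _ => ?_
  rw [← mul_assoc (2 * (q : ℝ) + 1)]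
  exact mul_le_mul_of_nonneg_right (sub_mul_pow_sub_pow_le _ _ _) (sq_nonneg _)

theorem trace_diagonal_mul_conj_diagonal_pow {U : Matrix ι ι ℝ} (hU : Uᵀ * U = 1)
    (hU' : U * Uᵀ = 1) (d f : ι → ℝ) (k : ℕ) :
    (Matrix.diagonal d * (U * Matrix.diagonal f * Uᵀ) ^ k).trace =
      ∑ i, ∑ j, d i * f j ^ k * U i j ^ 2 := by
  have h := trace_conj_diagonal_mul 1 U d (fun j => f j ^ k)
  simp only [Matrix.transpose_one, Matrix.one_mul, Matrix.mul_one] at h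
  rw [conj_diagonal_pow hU hU', h]

theorem trace_diagonal_mul_even_pow_nonneg {A : Matrix ι ι ℝ} (hA : A.IsSymm) {d : ι → ℝ}
    (hd : ∀ i, 0 ≤ d i) (q : ℕ) : 0 ≤ (Matrix.diagonal d * A ^ (2 * q)).trace := by
  obtain ⟨U, f, hU, hU', rfl⟩ := hA.exists_orthogonal_diagonalization
  rw [trace_diagonal_mul_conj_diagonal_pow hU hU']
  refine Finset.sum_nonneg fun i _ => Finset.sum_nonneg fun j _ => ?_
  exact mul_nonneg (mul_nonneg (hd i) ((even_two_mul q).pow_nonneg _)) (sq_nonneg _)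

/-- Compare y with 2x. The factor 1/2 on the power of y is what later allows the moment to be
absorbed. -/
theorem mul_pow_le_half_pow_add {x y : ℝ} (hx : 0 ≤ x) (hy : 0 ≤ y) (q : ℕ) :
    x * y ^ q ≤ y ^ (q + 1) / 2 + (2 * x) ^ (q + 1) := by
  rcases le_total (2 * x) y with h | h
  · have : x * y ^ q ≤ y / 2 * y ^ q := by gcongr; linarith
    have h2 : 0 ≤ (2 * x) ^ (q + 1) := by positivity
    calc _ ≤ y / 2 * y ^ q := this
      _ = y ^ (q + 1) / 2 := by ring
      _ ≤ _ := by linarith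
  · have h1 : x * y ^ q ≤ (2 * x) * (2 * x) ^ q := by gcongr; linarith
    have h2 : 0 ≤ y ^ (q + 1) := by positivity
    calc _ ≤ (2 * x) * (2 * x) ^ q := h1
      _ = (2 * x) ^ (q + 1) := by ring
      _ ≤ _ := by linarith

/-- A Young inequality for the trace of a nonnegative diagonal matrix against an even power. -/
theorem trace_diagonal_mul_even_pow_le {A : Matrix ι ι ℝ} (hA : A.IsSymm) {d : ι → ℝ}
    (hd : ∀ i, 0 ≤ d i) (q : ℕ) :
    (Matrix.diagonal d * A ^ (2 * q)).trace ≤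
      (A ^ (2 * (q + 1))).trace / 2 + ∑ i, (2 * d i) ^ (q + 1) := by
  obtain ⟨U, f, hU, hU', rfl⟩ := hA.exists_orthogonal_diagonalization
  have hone := trace_diagonal_mul_conj_diagonal_pow hU hU' 1 f (2 * (q + 1))
  rw [show Matrix.diagonal (1 : ι → ℝ) = 1 from Matrix.diagonal_one, Matrix.one_mul] at hone
  have hrow : ∀ i, ∑ j, U i j ^ 2 = 1 := fun i => by
    have := congrFun (congrFun hU' i) i
    simp only [Matrix.mul_apply, Matrix.transpose_apply, Matrix.one_apply_eq] at this
    simpa only [sq] using this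
  rw [trace_diagonal_mul_conj_diagonal_pow hU hU', hone]
  -- The rows of U are unit vectors, so all three terms become sums with the same weights and
  -- compare termwise.
  have hlast : ∑ i, (2 * d i) ^ (q + 1) = ∑ i, ∑ j, (2 * d i) ^ (q + 1) * U i j ^ 2 := by
    refine Finset.sum_congr rfl fun i _ => ?_
    rw [← Finset.mul_sum, hrow, mul_one]
  rw [hlast, Finset.sum_div, ← Finset.sum_add_distrib]
  refine Finset.sum_le_sum fun i _ => ?_
  rw [Finset.sum_div, ← Finset.sum_add_distrib]
  refine Finset.sum_le_sum fun j _ => ?_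
  have := mul_le_mul_of_nonneg_right
    (mul_pow_le_half_pow_add (hd i) (sq_nonneg (f j)) q) (sq_nonneg (U i j))
  rw [← pow_mul, ← pow_mul] at this
  simp only [Pi.one_apply]
  linarith

omit [DecidableEq ι] in
theorem l2_opNorm_le_one_of_transpose_mul_self {κ : Type*} [Fintype κ] [DecidableEq κ]
    {U : Matrix ι κ ℝ} (hU : Uᵀ * U = 1) : ‖U‖ ≤ 1 := by
  have h : ‖Uᴴ * U‖ = ‖U‖ * ‖U‖ := Matrix.l2_opNorm_conjTranspose_mul_self U
  rw [Matrix.conjTranspose_eq_transpose_of_trivial, hU] at h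
  have h1 : ‖(1 : Matrix κ κ ℝ)‖ ≤ 1 := by
    rw [← Matrix.diagonal_one, Matrix.l2_opNorm_diagonal]
    exact (pi_norm_le_iff_of_nonneg zero_le_one).2 fun i => by simp
  nlinarith [norm_nonneg U]

/-- The even Schatten norms dominate the spectral norm. -/
theorem l2_opNorm_pow_le_trace_pow {A : Matrix ι ι ℝ} (hA : A.IsSymm) {k : ℕ}
    (hk : Even k) (hk0 : k ≠ 0) :
    ‖A‖ ^ k ≤ (A ^ k).trace := by
  obtain ⟨U, f, hU, hU', rfl⟩ := hA.exists_orthogonal_diagonalization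
  have htr : ((U * Matrix.diagonal f * Uᵀ) ^ k).trace = ∑ j, f j ^ k := by
    rw [conj_diagonal_pow hU hU', Matrix.mul_assoc, Matrix.trace_mul_comm, Matrix.mul_assoc, hU,
      Matrix.mul_one, Matrix.trace_diagonal]
  have hnonneg : 0 ≤ ∑ j, f j ^ k := Finset.sum_nonneg fun j _ => hk.pow_nonneg _
  have hnorm : ‖U * Matrix.diagonal f * Uᵀ‖ ≤ ‖f‖ := by
    have hUt : ‖Uᵀ‖ ≤ 1 := l2_opNorm_le_one_of_transpose_mul_self (by simpa using hU')
    have hU1 := l2_opNorm_le_one_of_transpose_mul_self hU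
    calc ‖U * Matrix.diagonal f * Uᵀ‖ ≤ ‖U * Matrix.diagonal f‖ * ‖Uᵀ‖ := Matrix.l2_opNorm_mul _ _
      _ ≤ (‖U‖ * ‖Matrix.diagonal f‖) * ‖Uᵀ‖ := by gcongr; exact Matrix.l2_opNorm_mul _ _
      _ ≤ (1 * ‖Matrix.diagonal f‖) * 1 := by gcongr
      _ = ‖f‖ := by rw [one_mul, mul_one, Matrix.l2_opNorm_diagonal]
  rw [htr]
  refine (pow_le_pow_left₀ (norm_nonneg _) hnorm k).trans ?_
  rcases isEmpty_or_nonempty ι with h | h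
  · rw [Subsingleton.elim f 0, norm_zero, zero_pow hk0]
    simp
  · obtain ⟨i, -, hi⟩ := Finset.exists_mem_eq_sup' Finset.univ_nonempty fun i => ‖f i‖
    have : ‖f‖ ≤ |f i| := by
      refine (pi_norm_le_iff_of_nonneg (abs_nonneg _)).2 fun j => ?_
      rw [← Real.norm_eq_abs, ← hi]
      exact Finset.le_sup' (fun i => ‖f i‖) (Finset.mem_univ j)
    calc ‖f‖ ^ k ≤ |f i| ^ k := pow_le_pow_left₀ (norm_nonneg _) this k
      _ = f i ^ k := hk.pow_abs _
      _ ≤ _ := Finset.single_le_sum (f := fun j => f j ^ k)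
        (fun j _ => hk.pow_nonneg _) (Finset.mem_univ i)

end TraceInequalities

/-! ### Expectations over a Bernoulli random subset. -/

section BernoulliSubset

variable {κ : Type*} [Fintype κ] [DecidableEq κ]

/-- The probability of `T` for a random subset containing each element independently with
probability `p`. -/
noncomputable def bernoulliWeight (p : ℝ) (T : Finset κ) : ℝ :=
  ∏ k, if k ∈ T then p else 1 - p

/-- The expectation of `F` under a random subset containing each element independently with
probability `p`. -/
noncomputable def bernoulliExp (p : ℝ) (F : Finset κ → ℝ) : ℝ :=
  ∑ T, bernoulliWeight p T * F T

theorem bernoulliWeight_nonneg {p : ℝ} (hp0 : 0 ≤ p) (hp1 : p ≤ 1) (T : Finset κ) :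
    0 ≤ bernoulliWeight p T :=
  Finset.prod_nonneg fun k _ => by split_ifs <;> linarith

theorem bernoulliExp_mono {p : ℝ} (hp0 : 0 ≤ p) (hp1 : p ≤ 1) {F G : Finset κ → ℝ}
    (h : ∀ T, F T ≤ G T) : bernoulliExp p F ≤ bernoulliExp p G :=
  Finset.sum_le_sum fun T _ => mul_le_mul_of_nonneg_left (h T) (bernoulliWeight_nonneg hp0 hp1 T)

theorem bernoulliExp_add (p : ℝ) (F G : Finset κ → ℝ) :
    bernoulliExp p (fun T => F T + G T) = bernoulliExp p F + bernoulliExp p G := by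
  simp only [bernoulliExp, mul_add, Finset.sum_add_distrib]

theorem bernoulliExp_const_mul (p c : ℝ) (F : Finset κ → ℝ) :
    bernoulliExp p (fun T => c * F T) = c * bernoulliExp p F := by
  simp only [bernoulliExp, Finset.mul_sum]
  exact Finset.sum_congr rfl fun T _ => by ring

theorem bernoulliExp_sum {α : Type*} (s : Finset α) (p : ℝ) (F : α → Finset κ → ℝ) :
    bernoulliExp p (fun T => ∑ a ∈ s, F a T) = ∑ a ∈ s, bernoulliExp p (F a) := by
  simp only [bernoulliExp, Finset.mul_sum]
  exact Finset.sum_comm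

theorem bernoulliExp_prod (p : ℝ) (f : κ → Bool → ℝ) :
    bernoulliExp p (fun T => ∏ k, f k (decide (k ∈ T))) =
      ∏ k, (p * f k true + (1 - p) * f k false) := by
  rw [Finset.prod_add, Finset.powerset_univ]
  refine Finset.sum_congr rfl fun T _ => ?_
  rw [bernoulliWeight, ← Finset.prod_mul_distrib,
    ← Finset.prod_sdiff (Finset.subset_univ T), mul_comm]
  congr 1
  · exact Finset.prod_congr rfl fun k hk => by simp [hk]
  · refine Finset.prod_congr rfl fun k hk => ?_
    have : k ∉ T := (Finset.mem_sdiff.1 hk).2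
    simp [this]

theorem sum_finset_eq_sum_erase (k : κ) (G : Finset κ → ℝ) :
    ∑ T, G T = ∑ T ∈ (Finset.univ.erase k).powerset, (G T + G (insert k T)) := by
  rw [← Finset.powerset_univ, Finset.sum_add_distrib,
    ← Finset.sum_powerset_insert (Finset.notMem_erase k _),
    Finset.insert_erase (Finset.mem_univ k)]

theorem bernoulliWeight_eq_mul_erase (p : ℝ) (k : κ) (T : Finset κ) :
    bernoulliWeight p T = (if k ∈ T then p else 1 - p) *
      ∏ j ∈ Finset.univ.erase k, if j ∈ T then p else 1 - p :=
  (Finset.mul_prod_erase _ _ (Finset.mem_univ k)).symm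

/-- Cross-multiplied form of the likelihood ratio, valid also for p = 1. -/
theorem bernoulliWeight_insert_mul (p : ℝ) {k : κ} {T : Finset κ} (hk : k ∉ T) :
    (1 - p) * bernoulliWeight p (insert k T) = p * bernoulliWeight p T := by
  have h : ∏ j ∈ Finset.univ.erase k, (if j ∈ insert k T then p else 1 - p) =
      ∏ j ∈ Finset.univ.erase k, if j ∈ T then p else 1 - p :=
    Finset.prod_congr rfl fun j hj => by simp [Finset.ne_of_mem_erase hj]
  rw [bernoulliWeight_eq_mul_erase p k, bernoulliWeight_eq_mul_erase p k T, h]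
  simp only [Finset.mem_insert_self, if_true, if_neg hk]
  ring

/-- Resampling a single element. -/
theorem bernoulliExp_insert (p : ℝ) (k : κ) (F : Finset κ → ℝ) :
    p * bernoulliExp p (fun T => F (insert k T)) =
      bernoulliExp p (fun T => if k ∈ T then F T else 0) := by
  simp only [bernoulliExp]
  rw [sum_finset_eq_sum_erase k, sum_finset_eq_sum_erase k, Finset.mul_sum]
  refine Finset.sum_congr rfl fun T hT => ?_
  have hk : k ∉ T := fun h => by simpa using Finset.mem_powerset.1 hT h
  have := bernoulliWeight_insert_mul p hk
  simp only [hk, Finset.mem_insert_self, Finset.insert_idem, if_true, if_false]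
  linear_combination (-F (insert k T)) * this

theorem bernoulliExp_erase (p : ℝ) (k : κ) (F : Finset κ → ℝ) :
    (1 - p) * bernoulliExp p (fun T => F (T.erase k)) =
      bernoulliExp p (fun T => if k ∈ T then 0 else F T) := by
  simp only [bernoulliExp]
  rw [sum_finset_eq_sum_erase k, sum_finset_eq_sum_erase k, Finset.mul_sum]
  refine Finset.sum_congr rfl fun T hT => ?_
  have hk : k ∉ T := fun h => by simpa using Finset.mem_powerset.1 hT h
  have := bernoulliWeight_insert_mul p hk
  simp only [hk, Finset.mem_insert_self, Finset.erase_insert hk, Finset.erase_eq_of_notMem hk,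
    if_true, if_false]
  linear_combination F T * this

/-- Discrete integration by parts: a centered coefficient acts as a difference operator in the k-th
coordinate. -/
theorem bernoulliExp_centered {p : ℝ} (hp : p ≠ 0) (k : κ) (F : Finset κ → ℝ) :
    bernoulliExp p (fun T => ((if k ∈ T then p⁻¹ else 0) - 1) * F T) =
      (1 - p) * bernoulliExp p (fun T => F (insert k T) - F (T.erase k)) := by
  have h1 := bernoulliExp_insert p k F
  have h2 := bernoulliExp_erase p k F
  have e1 : bernoulliExp p (fun T => ((if k ∈ T then p⁻¹ else 0) - 1) * F T) =
      (p⁻¹ - 1) * bernoulliExp p (fun T => if k ∈ T then F T else 0) +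
        (-1) * bernoulliExp p (fun T => if k ∈ T then 0 else F T) := by
    rw [← bernoulliExp_const_mul, ← bernoulliExp_const_mul, ← bernoulliExp_add]
    congr 1
    funext T
    split_ifs <;> ring
  have e2 : bernoulliExp p (fun T => F (insert k T) - F (T.erase k)) =
      bernoulliExp p (fun T => F (insert k T)) + (-1) * bernoulliExp p (fun T => F (T.erase k)) := by
    rw [← bernoulliExp_const_mul, ← bernoulliExp_add]
    congr 1
    funext T
    ring
  rw [e1, e2, ← h1, ← h2]
  field_simp

/-- A Rosenthal-type moment bound for weighted counts of a random subset. -/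
theorem bernoulliExp_pow_le {p : ℝ} (hp0 : 0 < p) (hp1 : p ≤ 1) {y : κ → ℝ} (hy : ∀ k, 0 ≤ y k)
    {b v : ℝ} (hb : 0 < b) (hyb : ∀ k, y k ≤ b) (hv : ∑ k, p * y k ≤ v) {q : ℕ} (hq : 0 < q) :
    bernoulliExp p (fun T => (∑ k, y k * ((if k ∈ T then 1 else 0) + p)) ^ q) ≤
      (Real.exp 3 * (v + q * b)) ^ q := by
  have hq' : (0 : ℝ) < q := by exact_mod_cast hq
  have hv0 : 0 ≤ v := le_trans (Finset.sum_nonneg fun k _ => mul_nonneg hp0.le (hy k)) hv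
  have hden : 0 < v + q * b := by positivity
  -- The exponential parameter for which both τb ≤ 1 and τv ≤ q; the power is then bounded through
  -- x^q ≤ q! e^x and q! ≤ q^q.
  set τ : ℝ := q / (v + q * b) with hτ
  have hτ0 : 0 < τ := by positivity
  have hτb : τ * b ≤ 1 := by
    rw [hτ, div_mul_eq_mul_div, div_le_one hden]; linarith
  have hτv : τ * v ≤ q := by
    rw [hτ, div_mul_eq_mul_div, div_le_iff₀ hden]; nlinarith [mul_pos hq' hb]
  obtain ⟨f, hf⟩ : ∃ f : κ → Bool → ℝ, f = fun k c =>
    Real.exp (τ * (y k * ((if c then 1 else 0) + p))) := ⟨_, rfl⟩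
  have hstep : ∀ T : Finset κ, (∑ k, y k * ((if k ∈ T then 1 else 0) + p)) ^ q ≤
      (v + q * b) ^ q * ∏ k, f k (decide (k ∈ T)) := fun T => by
    set x := ∑ k, y k * ((if k ∈ T then 1 else 0) + p) with hx
    have hx0 : 0 ≤ x := Finset.sum_nonneg fun k _ =>
      mul_nonneg (hy k) (by split_ifs <;> linarith)
    have h1 : (τ * x) ^ q / q.factorial ≤ Real.exp (τ * x) :=
      Real.pow_div_factorial_le_exp _ (by positivity) q
    have h2 : (q.factorial : ℝ) ≤ (q : ℝ) ^ q := by exact_mod_cast Nat.factorial_le_pow q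
    have h3 : (τ * x) ^ q ≤ (q : ℝ) ^ q * Real.exp (τ * x) := by
      rw [div_le_iff₀ (by positivity)] at h1
      calc _ ≤ _ := h1
        _ = q.factorial * Real.exp (τ * x) := mul_comm _ _
        _ ≤ _ := by gcongr
    have h4 : x ^ q = (v + q * b) ^ q * ((τ * x) ^ q / (q : ℝ) ^ q) := by
      rw [← div_pow, ← mul_pow, hτ]
      congr 1
      field_simp
    have h5 : ∏ k, f k (decide (k ∈ T)) = Real.exp (τ * x) := by
      simp only [hf, decide_eq_true_eq]
      rw [← Real.exp_sum, hx, Finset.mul_sum]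
    rw [h5, h4]
    gcongr
    rw [div_le_iff₀ (by positivity)]
    exact h3.trans_eq (mul_comm _ _)
  refine (bernoulliExp_mono hp0.le hp1 hstep).trans ?_
  rw [bernoulliExp_const_mul, bernoulliExp_prod, mul_pow, mul_comm, ← Real.exp_nat_mul]
  refine mul_le_mul_of_nonneg_right ?_ (by positivity)
  -- Of the constant 3, two units come from e^z ≤ 1 + 2z on [0, 1] and one from the deterministic
  -- shift p.
  have hfac : ∀ k, p * f k true + (1 - p) * f k false ≤
      Real.exp (3 * τ * (p * y k)) := fun k => by
    simp only [hf, if_true, Bool.false_eq_true, if_false, zero_add]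
    set z := τ * y k with hz
    have hz0 : 0 ≤ z := mul_nonneg hτ0.le (hy k)
    have hz1 : z ≤ 1 := le_trans (mul_le_mul_of_nonneg_left (hyb k) hτ0.le) hτb
    have hexp : Real.exp z ≤ 1 + 2 * z := by
      have := Real.abs_exp_sub_one_sub_id_le (x := z) (by rw [abs_of_nonneg hz0]; exact hz1)
      have := (abs_le.1 this).2
      nlinarith
    have e1 : τ * (y k * (1 + p)) = z + p * z := by rw [hz]; ring
    have e2 : τ * (y k * p) = p * z := by rw [hz]; ring
    have e3 : 3 * τ * (p * y k) = 2 * (p * z) + p * z := by rw [hz]; ring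
    rw [e1, e2, e3, Real.exp_add, Real.exp_add]
    have h6 : 2 * (p * z) + 1 ≤ Real.exp (2 * (p * z)) := Real.add_one_le_exp _
    have h7 : p * Real.exp z + (1 - p) ≤ Real.exp (2 * (p * z)) := by nlinarith
    nlinarith [Real.exp_pos (p * z)]
  refine (Finset.prod_le_prod (fun k _ => ?_) fun k _ => hfac k).trans ?_
  · have : 0 ≤ 1 - p := by linarith
    simp only [hf]
    positivity
  rw [← Real.exp_sum, ← Finset.mul_sum]
  refine Real.exp_le_exp.2 ?_
  have : τ * ∑ k, p * y k ≤ τ * v := mul_le_mul_of_nonneg_left hv hτ0.le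
  linarith

end BernoulliSubset

/-! ### Moments and tails of centered matrix sums. -/

section CenteredSum

variable {ι κ : Type*} [Fintype ι] [DecidableEq ι] [Fintype κ] [DecidableEq κ]

/-- The centered sum `∑ k, (p⁻¹ 1{k ∈ T} - 1) H k`. -/
noncomputable def centeredSum (p : ℝ) (H : κ → Matrix ι ι ℝ) (T : Finset κ) : Matrix ι ι ℝ :=
  ∑ k, ((if k ∈ T then p⁻¹ else 0) - 1) • H k

omit [Fintype ι] [DecidableEq ι] in
theorem centeredSum_insert_sub_erase (p : ℝ) (H : κ → Matrix ι ι ℝ) (T : Finset κ) (k : κ) :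
    centeredSum p H (insert k T) - centeredSum p H (T.erase k) = p⁻¹ • H k := by
  rw [centeredSum, centeredSum, ← Finset.sum_sub_distrib, Finset.sum_eq_single k]
  · simp [sub_smul]
  · intro j _ hj
    simp [hj]
  · simp

omit [Fintype ι] [DecidableEq ι] in
theorem centeredSum_isSymm (p : ℝ) {H : κ → Matrix ι ι ℝ} (hH : ∀ k, (H k).IsSymm)
    (T : Finset κ) : (centeredSum p H T).IsSymm := by
  rw [Matrix.IsSymm, centeredSum, Matrix.transpose_sum]
  exact Finset.sum_congr rfl fun k _ => by rw [Matrix.transpose_smul, (hH k).eq]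

variable {p : ℝ} {H : κ → Matrix ι ι ℝ} {h : κ → ι → ℝ}

/-- Integration by parts followed by the mean value inequality gives traces at `insert k T` and
`T.erase k`. Resampling k returns both to T, with coefficients p⁻²(1 - p) on k ∈ T and p⁻¹ off it;
enlarging 1 - p to 1 + p merges them into the single factor p⁻²(1{k ∈ T} + p). -/
theorem bernoulliExp_centered_trace_le (hp0 : 0 < p) (hp1 : p ≤ 1)
    (hH : ∀ k, (H k).IsSymm) (hsq : ∀ k, H k ^ 2 = Matrix.diagonal (h k)) (hh : ∀ k i, 0 ≤ h k i)
    (q : ℕ) (k : κ) :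
    bernoulliExp p (fun T => ((if k ∈ T then p⁻¹ else 0) - 1) *
        (H k * centeredSum p H T ^ (2 * q + 1)).trace) ≤
      (2 * q + 1) * bernoulliExp p (fun T => (p ^ 2)⁻¹ * ((if k ∈ T then 1 else 0) + p) *
        (Matrix.diagonal (h k) * centeredSum p H T ^ (2 * q)).trace) := by
  set S := centeredSum p H with hS
  have hsymm : ∀ T, (S T).IsSymm := centeredSum_isSymm p hH
  set G : Finset κ → ℝ := fun T => (Matrix.diagonal (h k) * S T ^ (2 * q)).trace with hG
  have hG0 : ∀ T, 0 ≤ G T := fun T => trace_diagonal_mul_even_pow_nonneg (hsymm T) (hh k) q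
  rw [bernoulliExp_centered hp0.ne' k (fun T => (H k * S T ^ (2 * q + 1)).trace)]
  have hdiff : ∀ T, (H k * S (insert k T) ^ (2 * q + 1)).trace -
      (H k * S (T.erase k) ^ (2 * q + 1)).trace ≤
      (2 * q + 1) * p⁻¹ * (G (insert k T) + G (T.erase k)) := fun T => by
    have hmv := trace_sub_mul_pow_sub_pow_le (hsymm (insert k T)) (hsymm (T.erase k)) q
    rw [hS, centeredSum_insert_sub_erase, smul_pow, hsq, ← hS, Matrix.smul_mul, Matrix.smul_mul,
      Matrix.trace_smul, Matrix.trace_smul, Matrix.mul_sub, Matrix.mul_add, Matrix.trace_sub,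
      Matrix.trace_add, smul_eq_mul, smul_eq_mul] at hmv
    have := mul_le_mul_of_nonneg_left hmv hp0.le
    rw [← mul_assoc, mul_inv_cancel₀ hp0.ne', one_mul] at this
    refine this.trans_eq ?_
    simp only [hG]
    field_simp
  have hp1' : 0 ≤ 1 - p := by linarith
  refine (mul_le_mul_of_nonneg_left (bernoulliExp_mono hp0.le hp1 hdiff) hp1').trans ?_
  rw [bernoulliExp_const_mul, bernoulliExp_add]
  have hI := bernoulliExp_insert p k G
  have hE := bernoulliExp_erase p k G
  set a := bernoulliExp p (fun T => if k ∈ T then G T else 0) with ha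
  set b := bernoulliExp p (fun T => if k ∈ T then 0 else G T) with hb
  have hexp0 : ∀ F : Finset κ → ℝ, (∀ T, 0 ≤ F T) → 0 ≤ bernoulliExp p F := fun F hF =>
    Finset.sum_nonneg fun T _ => mul_nonneg (bernoulliWeight_nonneg hp0.le hp1 T) (hF T)
  have ha0 : 0 ≤ a := hexp0 _ fun T => by split_ifs <;> simp [hG0]
  have hR : bernoulliExp p (fun T => (p ^ 2)⁻¹ * ((if k ∈ T then 1 else 0) + p) * G T) =
      (p ^ 2)⁻¹ * (1 + p) * a + p⁻¹ * b := by
    rw [ha, hb, ← bernoulliExp_const_mul, ← bernoulliExp_const_mul, ← bernoulliExp_add]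
    congr 1
    funext T
    split_ifs
    · ring
    · field_simp
      ring
  rw [hR]
  have hI' : bernoulliExp p (fun T => G (insert k T)) = p⁻¹ * a := by
    rw [← hI, ← mul_assoc, inv_mul_cancel₀ hp0.ne', one_mul]
  have e : (1 - p) * ((2 * q + 1) * p⁻¹ * (bernoulliExp p (fun T => G (insert k T)) +
      bernoulliExp p (fun T => G (T.erase k)))) =
      (2 * q + 1) * ((p ^ 2)⁻¹ * (1 - p) * a + p⁻¹ * b) := by
    rw [hI', ← hE]
    field_simp
  rw [e]
  have : (p ^ 2)⁻¹ * (1 - p) * a ≤ (p ^ 2)⁻¹ * (1 + p) * a := by gcongr; linarith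
  gcongr

/-- A matrix moment inequality of Burkholder type for independent centered Bernoulli sums whose
summands have diagonal squares. -/
theorem bernoulliExp_trace_pow_le (hp0 : 0 < p) (hp1 : p ≤ 1)
    (hH : ∀ k, (H k).IsSymm) (hsq : ∀ k, H k ^ 2 = Matrix.diagonal (h k)) (hh : ∀ k i, 0 ≤ h k i)
    (q : ℕ) :
    bernoulliExp p (fun T => (centeredSum p H T ^ (2 * (q + 1))).trace) ≤
      2 * (2 * (2 * q + 1)) ^ (q + 1) * ∑ i, bernoulliExp p (fun T =>
        (∑ k, ((p ^ 2)⁻¹ * h k i) * ((if k ∈ T then 1 else 0) + p)) ^ (q + 1)) := by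
  set S := centeredSum p H with hS
  have hsymm : ∀ T, (S T).IsSymm := centeredSum_isSymm p hH
  set D : Finset κ → ι → ℝ := fun T i =>
    ∑ k, ((p ^ 2)⁻¹ * h k i) * ((if k ∈ T then 1 else 0) + p) with hD
  have hD0 : ∀ T i, 0 ≤ D T i := fun T i => Finset.sum_nonneg fun k _ =>
    mul_nonneg (mul_nonneg (by positivity) (hh k i)) (by split_ifs <;> linarith)
  have hlhs : ∀ T, (S T ^ (2 * (q + 1))).trace =
      ∑ k, ((if k ∈ T then p⁻¹ else 0) - 1) * (H k * S T ^ (2 * q + 1)).trace := fun T => by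
    rw [show 2 * (q + 1) = 2 * q + 1 + 1 by ring, pow_succ']
    nth_rewrite 1 [hS]
    rw [centeredSum, Finset.sum_mul, Matrix.trace_sum]
    refine Finset.sum_congr rfl fun k _ => ?_
    rw [Matrix.smul_mul, Matrix.trace_smul, smul_eq_mul]
  have hrhs : ∀ T, ∑ k, (p ^ 2)⁻¹ * ((if k ∈ T then 1 else 0) + p) *
      (Matrix.diagonal (h k) * S T ^ (2 * q)).trace =
      (Matrix.diagonal (D T) * S T ^ (2 * q)).trace := fun T => by
    have : Matrix.diagonal (D T) = ∑ k, ((p ^ 2)⁻¹ * ((if k ∈ T then 1 else 0) + p)) •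
        Matrix.diagonal (h k) := by
      ext i j
      rw [Matrix.sum_apply, Matrix.diagonal_apply]
      simp only [Matrix.smul_apply, Matrix.diagonal_apply, smul_eq_mul]
      split_ifs
      · exact Finset.sum_congr rfl fun k _ => by ring
      · simp
    rw [this, Finset.sum_mul, Matrix.trace_sum]
    refine Finset.sum_congr rfl fun k _ => ?_
    rw [Matrix.smul_mul, Matrix.trace_smul, smul_eq_mul]
  have h1 : bernoulliExp p (fun T => (S T ^ (2 * (q + 1))).trace) ≤
      (2 * q + 1) * bernoulliExp p (fun T => (Matrix.diagonal (D T) * S T ^ (2 * q)).trace) := by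
    simp only [hlhs, ← hrhs]
    rw [bernoulliExp_sum, bernoulliExp_sum, Finset.mul_sum]
    exact Finset.sum_le_sum fun k _ => bernoulliExp_centered_trace_le hp0 hp1 hH hsq hh q k
  -- Young's inequality is applied to (2q + 1)D, so the trace moment carries exactly 1/2 and moves
  -- to the left side at the end.
  have h2 : ∀ T, (2 * q + 1) * (Matrix.diagonal (D T) * S T ^ (2 * q)).trace ≤
      2⁻¹ * (S T ^ (2 * (q + 1))).trace +
        (2 * (2 * q + 1)) ^ (q + 1) * ∑ i, D T i ^ (q + 1) := fun T => by
    have := trace_diagonal_mul_even_pow_le (hsymm T) (d := fun i => (2 * q + 1) * D T i)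
      (fun i => mul_nonneg (by positivity) (hD0 T i)) q
    have e : Matrix.diagonal (fun i => (2 * (q : ℝ) + 1) * D T i) =
        (2 * (q : ℝ) + 1) • Matrix.diagonal (D T) := by
      ext i j
      simp [Matrix.diagonal_apply]
    rw [e, Matrix.smul_mul, Matrix.trace_smul, smul_eq_mul] at this
    refine this.trans_eq ?_
    rw [Finset.mul_sum]
    congr 1
    · ring
    · refine Finset.sum_congr rfl fun i _ => ?_
      rw [← mul_pow]
      ring
  have h3 := bernoulliExp_mono hp0.le hp1 h2
  rw [bernoulliExp_const_mul, bernoulliExp_add, bernoulliExp_const_mul, bernoulliExp_const_mul,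
    bernoulliExp_sum] at h3
  linarith

/-- A matrix Bernstein tail bound. -/
theorem sum_bernoulliWeight_norm_centeredSum_gt_le (hp0 : 0 < p) (hp1 : p ≤ 1)
    (hH : ∀ k, (H k).IsSymm) (hsq : ∀ k, H k ^ 2 = Matrix.diagonal (h k)) (hh : ∀ k i, 0 ≤ h k i)
    {b v : ℝ} (hb : 0 < b) (hhb : ∀ k i, (p ^ 2)⁻¹ * h k i ≤ b)
    (hv : ∀ i, ∑ k, p⁻¹ * h k i ≤ v) {q : ℕ} (hq : 0 < q) {t : ℝ}
    (ht0 : 0 ≤ t) (ht : 4 * Real.exp 5 * q * (v + q * b) ≤ t ^ 2) [DecidablePred fun T =>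
      t < ‖centeredSum p H T‖] :
    ∑ T with t < ‖centeredSum p H T‖, bernoulliWeight p T ≤
      2 * Fintype.card ι * Real.exp (-(2 * q)) := by
  rcases isEmpty_or_nonempty ι with hι | ⟨⟨i₀⟩⟩
  · rw [Finset.filter_false_of_mem]
    · simp
    · intro T _
      rw [Subsingleton.elim (centeredSum p H T) 0, norm_zero]
      exact not_lt.2 ht0
  have hq' : (0 : ℝ) < q := by exact_mod_cast hq
  have hv0 : 0 ≤ v := le_trans (Finset.sum_nonneg fun k _ =>
    mul_nonneg (by positivity) (hh k i₀)) (hv i₀)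
  set x := v + q * b with hx
  have hx0 : 0 < x := by positivity
  have hmom : bernoulliExp p (fun T => (centeredSum p H T ^ (2 * q)).trace) ≤
      2 * Fintype.card ι * (4 * q * Real.exp 3 * x) ^ q := by
    obtain ⟨q, rfl⟩ : ∃ k, q = k + 1 := ⟨q - 1, by omega⟩
    refine (bernoulliExp_trace_pow_le hp0 hp1 hH hsq hh q).trans ?_
    have hrow : ∀ i, bernoulliExp p (fun T =>
        (∑ k, ((p ^ 2)⁻¹ * h k i) * ((if k ∈ T then 1 else 0) + p)) ^ (q + 1)) ≤
        (Real.exp 3 * x) ^ (q + 1) := fun i => by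
      refine bernoulliExp_pow_le hp0 hp1 (fun k => mul_nonneg (by positivity) (hh k i)) hb
        (fun k => hhb k i) ?_ hq
      refine (Finset.sum_congr rfl fun k _ => ?_).trans_le (hv i)
      field_simp
    calc _ ≤ 2 * (2 * (2 * (q : ℝ) + 1)) ^ (q + 1) * ∑ _i : ι, (Real.exp 3 * x) ^ (q + 1) := by
          gcongr with i
          exact hrow i
      _ ≤ 2 * (4 * ((q + 1 : ℕ) : ℝ)) ^ (q + 1) * ∑ _i : ι, (Real.exp 3 * x) ^ (q + 1) := by
          have : 2 * (2 * (q : ℝ) + 1) ≤ 4 * ((q + 1 : ℕ) : ℝ) := by push_cast; linarith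
          gcongr
      _ = _ := by
          rw [Finset.sum_const, Finset.card_univ, nsmul_eq_mul, mul_pow, mul_pow _ x, mul_pow _ x,
            mul_pow _ (Real.exp 3)]
          ring
  have ht2 : 0 < t ^ 2 := lt_of_lt_of_le (by positivity) ht
  have hmarkov : (∑ T with t < ‖centeredSum p H T‖, bernoulliWeight p T) * t ^ (2 * q) ≤
      bernoulliExp p (fun T => (centeredSum p H T ^ (2 * q)).trace) := by
    rw [Finset.sum_mul, Finset.sum_filter]
    refine Finset.sum_le_sum fun T _ => ?_
    have hw := bernoulliWeight_nonneg hp0.le hp1 T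
    have htr := l2_opNorm_pow_le_trace_pow (centeredSum_isSymm p hH T) (even_two_mul q)
      (by omega)
    split_ifs with hT
    · refine mul_le_mul_of_nonneg_left (le_trans ?_ htr) hw
      exact pow_le_pow_left₀ ht0 hT.le _
    · exact mul_nonneg hw (le_trans (by positivity) htr)
  -- The e⁵ assumed in `ht` splits as e³ from the scalar moments and e², which supplies the decay
  -- e^(-2q).
  have hpow : (4 * q * Real.exp 3 * x) ^ q ≤ Real.exp (-(2 * q)) * t ^ (2 * q) := by
    have : 4 * q * Real.exp 3 * x ≤ Real.exp (-2) * t ^ 2 := by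
      calc 4 * q * Real.exp 3 * x = Real.exp (-2) * (4 * Real.exp 5 * q * x) := by
            rw [show (3 : ℝ) = -2 + 5 by norm_num, Real.exp_add]; ring
        _ ≤ _ := by gcongr
    calc _ ≤ (Real.exp (-2) * t ^ 2) ^ q := pow_le_pow_left₀ (by positivity) this q
      _ = _ := by
        rw [mul_pow, ← Real.exp_nat_mul, ← pow_mul]
        congr 2
        ring
  refine le_of_mul_le_mul_right ((hmarkov.trans hmom).trans ?_)
    (show 0 < t ^ (2 * q) by rw [pow_mul]; positivity)
  rw [mul_assoc (2 * (Fintype.card ι : ℝ))]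
  exact mul_le_mul_of_nonneg_left hpow (by positivity)

end CenteredSum

/-! ### Entry, row and column bounds from incoherence. -/

section SingularValues

variable {n m r : ℕ} {A : Matrix (Fin n) (Fin m) ℝ} {U : Matrix (Fin n) (Fin r) ℝ}
  {σ : Fin r → ℝ} {V : Matrix (Fin m) (Fin r) ℝ}

theorem l2_opNorm_transpose (A : Matrix (Fin n) (Fin m) ℝ) : ‖Aᵀ‖ = ‖A‖ := by
  rw [← Matrix.conjTranspose_eq_transpose_of_trivial, Matrix.l2_opNorm_conjTranspose]

namespace IsCompactSVD

theorem transpose (hA : IsCompactSVD A U σ V) : IsCompactSVD Aᵀ V σ U where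
  left_orthonormal := hA.right_orthonormal
  right_orthonormal := hA.left_orthonormal
  sigma_pos := hA.sigma_pos
  sigma_antitone := hA.sigma_antitone
  eq_mul := by
    rw [hA.eq_mul, Matrix.transpose_mul, Matrix.transpose_mul, Matrix.transpose_transpose,
      Matrix.diagonal_transpose, Matrix.mul_assoc]

theorem sigma_le (hA : IsCompactSVD A U σ V) (k : Fin r) : σ k ≤ ‖A‖ := by
  have e : Matrix.diagonal σ = Uᵀ * A * V := by
    rw [hA.eq_mul]
    calc Matrix.diagonal σ = (Uᵀ * U) * Matrix.diagonal σ * (Vᵀ * V) := by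
          rw [hA.left_orthonormal, hA.right_orthonormal, Matrix.one_mul, Matrix.mul_one]
      _ = _ := by simp only [Matrix.mul_assoc]
  have hU := l2_opNorm_le_one_of_transpose_mul_self hA.left_orthonormal
  have hV := l2_opNorm_le_one_of_transpose_mul_self hA.right_orthonormal
  rw [← l2_opNorm_transpose] at hU
  calc σ k ≤ ‖σ k‖ := Real.le_norm_self _
    _ ≤ ‖σ‖ := norm_le_pi_norm σ k
    _ = ‖Matrix.diagonal σ‖ := (Matrix.l2_opNorm_diagonal σ).symm
    _ = ‖Uᵀ * A * V‖ := by rw [e]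
    _ ≤ ‖Uᵀ * A‖ * ‖V‖ := Matrix.l2_opNorm_mul _ _
    _ ≤ (‖Uᵀ‖ * ‖A‖) * ‖V‖ := by gcongr; exact Matrix.l2_opNorm_mul _ _
    _ ≤ (1 * ‖A‖) * 1 := by gcongr
    _ = ‖A‖ := by ring

theorem sum_sigma_sq_mul_sq_le (hA : IsCompactSVD A U σ V) (x : Fin r → ℝ) :
    ∑ k, (σ k * x k) ^ 2 ≤ ‖A‖ ^ 2 * ∑ k, x k ^ 2 := by
  rw [Finset.mul_sum]
  refine Finset.sum_le_sum fun k _ => ?_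
  rw [mul_pow]
  have h0 := (hA.sigma_pos k).le
  have := hA.sigma_le k
  gcongr

theorem entry_eq (hA : IsCompactSVD A U σ V) (i : Fin n) (l : Fin m) :
    A i l = ∑ k, U i k * (σ k * V l k) := by
  conv_lhs => rw [hA.eq_mul]
  rw [Matrix.mul_apply]
  refine Finset.sum_congr rfl fun k _ => ?_
  rw [Matrix.mul_diagonal, Matrix.transpose_apply, mul_assoc]

/-- Cauchy–Schwarz between row i of U and row l of V scaled by the singular values, each at most
‖A‖. -/
theorem entry_sq_le (hA : IsCompactSVD A U σ V) (i : Fin n) (l : Fin m) :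
    A i l ^ 2 ≤ ‖A‖ ^ 2 * ((∑ k, U i k ^ 2) * ∑ k, V l k ^ 2) := by
  rw [hA.entry_eq i l]
  refine (Finset.sum_mul_sq_le_sq_mul_sq _ _ _).trans ?_
  calc _ ≤ (∑ k, U i k ^ 2) * (‖A‖ ^ 2 * ∑ k, V l k ^ 2) :=
        mul_le_mul_of_nonneg_left (hA.sum_sigma_sq_mul_sq_le _)
          (Finset.sum_nonneg fun _ _ => sq_nonneg _)
    _ = _ := by ring

theorem sum_row_sq_le (hA : IsCompactSVD A U σ V) (i : Fin n) :
    ∑ l, A i l ^ 2 ≤ ‖A‖ ^ 2 * ∑ k, U i k ^ 2 := by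
  have e : A * Aᵀ = (U * Matrix.diagonal σ) * (U * Matrix.diagonal σ)ᵀ := by
    conv_lhs => rw [hA.eq_mul]
    rw [Matrix.transpose_mul (U * Matrix.diagonal σ), Matrix.transpose_transpose,
      Matrix.mul_assoc (U * Matrix.diagonal σ), ← Matrix.mul_assoc Vᵀ, hA.right_orthonormal,
      Matrix.one_mul]
  have h1 : ∑ l, A i l ^ 2 = (A * Aᵀ) i i := by
    rw [Matrix.mul_apply]
    exact Finset.sum_congr rfl fun l _ => sq _
  rw [h1, e, Matrix.mul_apply]
  refine le_trans (le_of_eq ?_) (hA.sum_sigma_sq_mul_sq_le (U i))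
  refine Finset.sum_congr rfl fun k _ => ?_
  rw [Matrix.transpose_apply, Matrix.mul_diagonal]
  ring

end IsCompactSVD

theorem IsIncoherent.entry_sq_le {μ₁ μ₂ : ℝ} (hA : IsIncoherent μ₁ μ₂ A) (i : Fin n)
    (l : Fin m) : A i l ^ 2 ≤ ‖A‖ ^ 2 * (μ₁ * A.rank / n * (μ₂ * A.rank / m)) := by
  obtain ⟨U, σ, V, h, hU, hV⟩ := hA
  refine (h.entry_sq_le i l).trans ?_
  have h1 := hU i
  have h2 := hV l
  rw [EuclideanSpace.real_norm_sq_eq] at h1 h2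
  have h3 : 0 ≤ ∑ k, V l k ^ 2 := Finset.sum_nonneg fun _ _ => sq_nonneg _
  have h4 : 0 ≤ ∑ k, U i k ^ 2 := Finset.sum_nonneg fun _ _ => sq_nonneg _
  exact mul_le_mul_of_nonneg_left (mul_le_mul h1 h2 h3 (h4.trans h1)) (sq_nonneg _)

theorem IsIncoherent.sum_row_sq_le {μ₁ μ₂ : ℝ} (hA : IsIncoherent μ₁ μ₂ A) (i : Fin n) :
    ∑ l, A i l ^ 2 ≤ ‖A‖ ^ 2 * (μ₁ * A.rank / n) := by
  obtain ⟨U, σ, V, h, hU, -⟩ := hA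
  have h1 := hU i
  rw [EuclideanSpace.real_norm_sq_eq] at h1
  exact (h.sum_row_sq_le i).trans (mul_le_mul_of_nonneg_left h1 (sq_nonneg _))

theorem IsIncoherent.sum_col_sq_le {μ₁ μ₂ : ℝ} (hA : IsIncoherent μ₁ μ₂ A) (l : Fin m) :
    ∑ i, A i l ^ 2 ≤ ‖A‖ ^ 2 * (μ₂ * A.rank / m) := by
  obtain ⟨U, σ, V, h, -, hV⟩ := hA
  have h1 := hV l
  rw [EuclideanSpace.real_norm_sq_eq] at h1
  have := h.transpose.sum_row_sq_le l
  rw [l2_opNorm_transpose] at this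
  exact this.trans (mul_le_mul_of_nonneg_left h1 (sq_nonneg _))

end SingularValues

/-! ### Wedge matrices: decomposition of the error, size and variance. -/

section Wedges

open Classical in
noncomputable instance (n m : ℕ) : Fintype (wedgeSet n m) := Fintype.ofFinite _

variable {n m : ℕ}

/-- The symmetrized matrix unit: `e_i e_jᵀ + e_j e_iᵀ` if `i ≠ j`, and `e_i e_iᵀ` if `i = j`. -/
def symmSingle (i j : Fin n) : Matrix (Fin n) (Fin n) ℝ :=
  if i = j then Matrix.single i i 1 else Matrix.single i j 1 + Matrix.single j i 1

/-- The contribution of the wedge `(i, ℓ, j)` to `A Aᵀ`. -/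
def wedgeMatrix (A : Matrix (Fin n) (Fin m) ℝ) (t : Fin n × Fin m × Fin n) :
    Matrix (Fin n) (Fin n) ℝ :=
  (A t.1 t.2.1 * A t.2.2 t.2.1) • symmSingle t.1 t.2.2

/-- The diagonal of the square of `wedgeMatrix A (i, ℓ, j)`. -/
def wedgeSqDiag (A : Matrix (Fin n) (Fin m) ℝ) (t : Fin n × Fin m × Fin n) (u : Fin n) : ℝ :=
  (A t.1 t.2.1 * A t.2.2 t.2.1) ^ 2 * if t.1 = u ∨ t.2.2 = u then 1 else 0

theorem symmSingle_isSymm (i j : Fin n) : (symmSingle i j).IsSymm := by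
  unfold symmSingle
  split_ifs
  · simp [Matrix.IsSymm]
  · simp [Matrix.IsSymm, add_comm]

/-- Symmetrizing makes the square diagonal, which is the structural hypothesis of the matrix moment
inequality. -/
theorem symmSingle_sq (i j : Fin n) :
    symmSingle i j ^ 2 = Matrix.diagonal fun u => if i = u ∨ j = u then 1 else 0 := by
  unfold symmSingle
  split_ifs with h
  · subst h
    ext a b
    simp only [sq, Matrix.single_mul_single_same, Matrix.single_apply, Matrix.diagonal_apply]
    grind
  · rw [sq, mul_add, add_mul, add_mul, Matrix.single_mul_single_same,
      Matrix.single_mul_single_same, Matrix.single_mul_single_of_ne (h := Ne.symm h),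
      Matrix.single_mul_single_of_ne (h := h)]
    ext a b
    simp only [Matrix.add_apply, Matrix.zero_apply, Matrix.single_apply, Matrix.diagonal_apply]
    grind

theorem wedgeMatrix_isSymm (A : Matrix (Fin n) (Fin m) ℝ) (t : Fin n × Fin m × Fin n) :
    (wedgeMatrix A t).IsSymm := by
  rw [Matrix.IsSymm, wedgeMatrix, Matrix.transpose_smul, (symmSingle_isSymm _ _).eq]

theorem wedgeMatrix_sq (A : Matrix (Fin n) (Fin m) ℝ) (t : Fin n × Fin m × Fin n) :
    wedgeMatrix A t ^ 2 = Matrix.diagonal (wedgeSqDiag A t) := by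
  rw [wedgeMatrix, smul_pow, symmSingle_sq]
  ext a b
  simp [Matrix.diagonal_apply, wedgeSqDiag]

theorem wedgeSqDiag_nonneg (A : Matrix (Fin n) (Fin m) ℝ) (t : Fin n × Fin m × Fin n)
    (u : Fin n) : 0 ≤ wedgeSqDiag A t u :=
  mul_nonneg (sq_nonneg _) (by split_ifs <;> norm_num)

theorem sum_wedgeSet {M : Type*} [AddCommMonoid M] (F : Fin n × Fin m × Fin n → M) :
    ∑ k : wedgeSet n m, F k =
      (∑ i, ∑ j ∈ Finset.Ioi i, ∑ l, F (i, l, j)) + ∑ i, ∑ l, F (i, l, i) := by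
  have h1 : ∑ k : wedgeSet n m, F k =
      ∑ t ∈ Finset.univ.filter (fun t : Fin n × Fin m × Fin n => t.1 ≤ t.2.2), F t :=
    (Finset.sum_subtype _ (fun t => by simp [wedgeSet]) F).symm
  rw [h1, Finset.sum_filter, Fintype.sum_prod_type, ← Finset.sum_add_distrib]
  refine Finset.sum_congr rfl fun i _ => ?_
  rw [Fintype.sum_prod_type, Finset.sum_comm, add_comm,
    Finset.add_sum_Ioi_eq_sum_Ici (f := fun j => ∑ l, F (i, l, j))]
  rw [← Finset.filter_le_eq_Ici, Finset.sum_filter]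
  refine Finset.sum_congr rfl fun j _ => ?_
  dsimp only
  split_ifs
  · rfl
  · simp

theorem sum_wedgeSet_le_sum {F : Fin n × Fin m × Fin n → ℝ} (hF : ∀ t, 0 ≤ F t) :
    ∑ k : wedgeSet n m, F k ≤ ∑ t, F t := by
  have h1 : ∑ k : wedgeSet n m, F k =
      ∑ t ∈ Finset.univ.filter (fun t : Fin n × Fin m × Fin n => t.1 ≤ t.2.2), F t :=
    (Finset.sum_subtype _ (fun t => by simp [wedgeSet]) F).symm
  rw [h1]
  exact Finset.sum_le_sum_of_subset_of_nonneg (Finset.subset_univ _) fun t _ _ => hF t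

open Classical in
theorem wedgeEstimator_eq_sum (p : ℝ) (A : Matrix (Fin n) (Fin m) ℝ)
    (W : Set (Fin n × Fin m × Fin n)) :
    wedgeEstimator p A W = ∑ k : wedgeSet n m,
      (if (k : Fin n × Fin m × Fin n) ∈ W then p⁻¹ else 0) • wedgeMatrix A k := by
  rw [sum_wedgeSet (fun t => (if t ∈ W then p⁻¹ else 0) • wedgeMatrix A t), wedgeEstimator]
  congr 1
  · refine Finset.sum_congr rfl fun i _ => Finset.sum_congr rfl fun j hj =>
      Finset.sum_congr rfl fun l _ => ?_
    have hij : i ≠ j := (Finset.mem_Ioi.1 hj).ne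
    simp only [wedgeTerm, wedgeMatrix, symmSingle, if_neg hij, Matrix.transpose_single, smul_add,
      Matrix.smul_single, smul_eq_mul, mul_one]
    split_ifs <;> simp [mul_assoc]
  · refine Finset.sum_congr rfl fun i _ => Finset.sum_congr rfl fun l _ => ?_
    simp only [wedgeTerm, wedgeMatrix, symmSingle, if_true, Matrix.smul_single, smul_eq_mul,
      mul_one]
    split_ifs <;> simp [mul_assoc]

/-- Unbiasedness of the estimator: each off-diagonal pair is counted once through its ordered
representative. -/
theorem sum_wedgeMatrix (A : Matrix (Fin n) (Fin m) ℝ) :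
    ∑ k : wedgeSet n m, wedgeMatrix A k = A * Aᵀ := by
  set g : Fin n → Fin n → Matrix (Fin n) (Fin n) ℝ := fun i j =>
    Matrix.single i j ((A * Aᵀ) i j) with hg
  have hgs : ∀ i j, g i j = ∑ l, (A i l * A j l) • Matrix.single i j (1 : ℝ) := fun i j => by
    ext a b
    simp only [hg, Matrix.sum_apply, Matrix.mul_apply, Matrix.transpose_apply, Matrix.single_apply,
      Matrix.smul_apply, smul_eq_mul]
    split_ifs <;> simp
  have htot : A * Aᵀ = ∑ i, ∑ j, g j i :=
    (Matrix.matrix_eq_sum_single (A * Aᵀ)).trans Finset.sum_comm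
  rw [sum_wedgeSet, htot]
  have hoff := Finset.sum_sum_Ioi_add_eq_sum_sum_off_diag g
  have hsplit : ∀ i, ∑ j, g j i = ∑ j ∈ ({i}ᶜ : Finset (Fin n)), g j i + g i i := fun i => by
    rw [← Finset.sum_compl_add_sum {i}, Finset.sum_singleton]
  simp only [hsplit]
  rw [Finset.sum_add_distrib, ← hoff]
  congr 1
  · refine Finset.sum_congr rfl fun i _ => Finset.sum_congr rfl fun j hj => ?_
    have hij : i ≠ j := (Finset.mem_Ioi.1 hj).ne
    rw [hgs, hgs, ← Finset.sum_add_distrib]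
    refine Finset.sum_congr rfl fun l _ => ?_
    simp only [wedgeMatrix, symmSingle, if_neg hij, smul_add]
    rw [add_comm, mul_comm (A j l)]
  · refine Finset.sum_congr rfl fun i _ => ?_
    rw [hgs]
    refine Finset.sum_congr rfl fun l _ => ?_
    simp only [wedgeMatrix, symmSingle, if_true]

open Classical in
theorem wedgeEstimator_sub_eq_centeredSum (p : ℝ) (A : Matrix (Fin n) (Fin m) ℝ)
    (W : Set (Fin n × Fin m × Fin n)) :
    wedgeEstimator p A W - A * Aᵀ =
      centeredSum p (fun k : wedgeSet n m => wedgeMatrix A k)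
        (Finset.univ.filter fun k : wedgeSet n m => (k : Fin n × Fin m × Fin n) ∈ W) := by
  rw [wedgeEstimator_eq_sum, ← sum_wedgeMatrix, ← Finset.sum_sub_distrib, centeredSum]
  refine Finset.sum_congr rfl fun k _ => ?_
  simp [sub_smul]

theorem IsIncoherent.wedgeSqDiag_le {A : Matrix (Fin n) (Fin m) ℝ} {μ₁ μ₂ : ℝ}
    (hA : IsIncoherent μ₁ μ₂ A) (t : Fin n × Fin m × Fin n) (u : Fin n) :
    wedgeSqDiag A t u ≤ (‖A‖ ^ 2 * (μ₁ * A.rank / n * (μ₂ * A.rank / m))) ^ 2 := by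
  have h1 := hA.entry_sq_le t.1 t.2.1
  have h2 := hA.entry_sq_le t.2.2 t.2.1
  have h3 : (A t.1 t.2.1 * A t.2.2 t.2.1) ^ 2 ≤
      (‖A‖ ^ 2 * (μ₁ * A.rank / n * (μ₂ * A.rank / m))) ^ 2 := by
    rw [mul_pow, sq (‖A‖ ^ 2 * _)]
    exact mul_le_mul h1 h2 (sq_nonneg _) ((sq_nonneg _).trans h1)
  unfold wedgeSqDiag
  split_ifs
  · simpa using h3
  · simpa using sq_nonneg _

/-- A wedge contributes at u only if its first or last index is u, hence the factor 2. In each case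
the sum over the other end is a column norm and the remaining sum over ℓ a row norm, so each
incoherence parameter enters once. -/
theorem IsIncoherent.sum_wedgeSqDiag_le {A : Matrix (Fin n) (Fin m) ℝ} {μ₁ μ₂ : ℝ}
    (hA : IsIncoherent μ₁ μ₂ A) (u : Fin n) :
    ∑ k : wedgeSet n m, wedgeSqDiag A k u ≤
      2 * (‖A‖ ^ 4 * (μ₁ * A.rank / n * (μ₂ * A.rank / m))) := by
  have key : ∑ j, ∑ l, A u l ^ 2 * A j l ^ 2 ≤
      ‖A‖ ^ 4 * (μ₁ * A.rank / n * (μ₂ * A.rank / m)) := by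
    rcases isEmpty_or_nonempty (Fin m) with hm | ⟨⟨l₀⟩⟩
    · have : m = 0 := (Fintype.card_fin m).symm.trans (Fintype.card_eq_zero_iff.2 hm)
      subst this
      simp
    rw [Finset.sum_comm]
    calc ∑ l, ∑ j, A u l ^ 2 * A j l ^ 2
        ≤ ∑ l, A u l ^ 2 * (‖A‖ ^ 2 * (μ₂ * A.rank / m)) := by
          refine Finset.sum_le_sum fun l _ => ?_
          rw [← Finset.mul_sum]
          exact mul_le_mul_of_nonneg_left (hA.sum_col_sq_le l) (sq_nonneg _)
      _ = (∑ l, A u l ^ 2) * (‖A‖ ^ 2 * (μ₂ * A.rank / m)) := (Finset.sum_mul _ _ _).symm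
      _ ≤ (‖A‖ ^ 2 * (μ₁ * A.rank / n)) * (‖A‖ ^ 2 * (μ₂ * A.rank / m)) :=
          mul_le_mul_of_nonneg_right (hA.sum_row_sq_le u)
            ((Finset.sum_nonneg fun _ _ => sq_nonneg _).trans (hA.sum_col_sq_le l₀))
      _ = _ := by ring
  refine (sum_wedgeSet_le_sum fun t => wedgeSqDiag_nonneg A t u).trans ?_
  have hle : ∀ t : Fin n × Fin m × Fin n, wedgeSqDiag A t u ≤
      (if t.1 = u then A u t.2.1 ^ 2 * A t.2.2 t.2.1 ^ 2 else 0) +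
        (if t.2.2 = u then A u t.2.1 ^ 2 * A t.1 t.2.1 ^ 2 else 0) := fun t => by
    have h0 : 0 ≤ A u t.2.1 ^ 2 * A u t.2.1 ^ 2 := by positivity
    unfold wedgeSqDiag
    by_cases h1 : t.1 = u <;> by_cases h2 : t.2.2 = u <;> simp [h1, h2] <;> nlinarith
  refine (Finset.sum_le_sum fun t _ => hle t).trans ?_
  rw [Finset.sum_add_distrib, two_mul]
  refine add_le_add (le_of_eq_of_le ?_ key) (le_of_eq_of_le ?_ key)
  · simp only [Fintype.sum_prod_type]
    rw [Finset.sum_eq_single u (fun i _ hi => by simp [hi]) (by simp)]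
    simp only [if_true]
    exact Finset.sum_comm
  · simp only [Fintype.sum_prod_type]
    simp

end Wedges

/-! ### Transfer to the probability space and choice of parameters. -/

open Classical in
theorem IsWedgeSample.real_eq_bernoulliWeight {n m : ℕ} {Ω : Type*} [MeasurableSpace Ω]
    {P : Measure Ω} [IsProbabilityMeasure P] {p : ℝ} {W : Ω → Set (Fin n × Fin m × Fin n)}
    (hW : IsWedgeSample P p W) (T : Finset (wedgeSet n m)) :
    P.real {ω | Finset.univ.filter (fun k : wedgeSet n m =>
      (k : Fin n × Fin m × Fin n) ∈ W ω) = T} = bernoulliWeight p T := by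
  set E : wedgeSet n m → Set Ω := fun k => {ω | (k : Fin n × Fin m × Fin n) ∈ W ω} with hE
  have hEm : ∀ k, MeasurableSet (E k) := fun k => hW.measurableSet_mem k k.2
  have hset : {ω | Finset.univ.filter (fun k : wedgeSet n m =>
      (k : Fin n × Fin m × Fin n) ∈ W ω) = T} = ⋂ k, if k ∈ T then E k else (E k)ᶜ := by
    ext ω
    simp only [Set.mem_ofPred_eq, Set.mem_iInter, Finset.ext_iff, Finset.mem_filter,
      Finset.mem_univ, true_and]
    refine forall_congr' fun k => ?_
    split_ifs with h <;> simp [h, hE]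
  -- Independence of the generated σ-algebras covers the complements that occur for k ∉ T.
  have hind := (iIndepSet_iff_iIndep _ _).1 hW.indep
  rw [hset, measureReal_def, hind.meas_iInter, ENNReal.toReal_prod, bernoulliWeight]
  · refine Finset.prod_congr rfl fun k _ => ?_
    rw [← measureReal_def]
    split_ifs
    · exact hW.prob_mem k k.2
    · rw [probReal_compl_eq_one_sub (hEm k)]
      congr 1
      exact hW.prob_mem k k.2
  · intro k
    have h : MeasurableSet[MeasurableSpace.generateFrom {E k}] (E k) :=
      MeasurableSpace.measurableSet_generateFrom (Set.mem_singleton _)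
    split_ifs
    · exact h
    · exact MeasurableSet.compl h

theorem IsWedgeSample.one_sub_le_real_norm_le {n m : ℕ} {Ω : Type*} [MeasurableSpace Ω]
    {P : Measure Ω} [IsProbabilityMeasure P] {p : ℝ} {W : Ω → Set (Fin n × Fin m × Fin n)}
    (hW : IsWedgeSample P p W) (hp0 : 0 < p) (hp1 : p ≤ 1) {A : Matrix (Fin n) (Fin m) ℝ}
    {b v : ℝ} (hb : 0 < b) (hAb : ∀ t u, (p ^ 2)⁻¹ * wedgeSqDiag A t u ≤ b)
    (hAv : ∀ u, p⁻¹ * ∑ k : wedgeSet n m, wedgeSqDiag A k u ≤ v) {q : ℕ} (hq : 0 < q) {t : ℝ}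
    (ht0 : 0 ≤ t) (ht : 4 * Real.exp 5 * q * (v + q * b) ≤ t ^ 2) :
    1 - 2 * n * Real.exp (-(2 * q)) ≤
      P.real {ω | ‖wedgeEstimator p A (W ω) - A * Aᵀ‖ ≤ t} := by
  classical
  set H : wedgeSet n m → Matrix (Fin n) (Fin n) ℝ := fun k => wedgeMatrix A k with hH
  set R : Ω → Finset (wedgeSet n m) := fun ω =>
    Finset.univ.filter fun k : wedgeSet n m => (k : Fin n × Fin m × Fin n) ∈ W ω with hR
  have htail := sum_bernoulliWeight_norm_centeredSum_gt_le (H := H)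
    (h := fun k => wedgeSqDiag A k) hp0 hp1 (fun k => wedgeMatrix_isSymm A k)
    (fun k => wedgeMatrix_sq A k) (fun k u => wedgeSqDiag_nonneg A k u) hb
    (fun k u => hAb k u) (fun u => by rw [← Finset.mul_sum]; exact hAv u) hq ht0 ht
  rw [Fintype.card_fin] at htail
  set good := {ω | ‖wedgeEstimator p A (W ω) - A * Aᵀ‖ ≤ t} with hgood
  have hbad : goodᶜ ⊆ ⋃ T ∈ Finset.univ.filter (fun T => t < ‖centeredSum p H T‖),
      {ω | R ω = T} := fun ω hω => by
    rw [hgood, Set.mem_compl_iff, Set.mem_ofPred_eq, not_le,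
      wedgeEstimator_sub_eq_centeredSum] at hω
    simp only [Set.mem_iUnion, Finset.mem_filter, Finset.mem_univ, true_and]
    exact ⟨R ω, hω, rfl⟩
  have h1 : P.real goodᶜ ≤ 2 * n * Real.exp (-(2 * q)) := by
    refine (measureReal_mono hbad (measure_ne_top _ _)).trans ((measureReal_biUnion_finset_le _ _).trans ?_)
    exact (Finset.sum_congr rfl fun T _ => hW.real_eq_bernoulliWeight T).trans_le htail
  -- Subadditivity suffices, so `good` need not be shown measurable.
  have h2 : 1 ≤ P.real good + P.real goodᶜ := by
    rw [← probReal_univ (μ := P), ← Set.union_compl_self good]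
    exact measureReal_union_le _ _
  linarith

/-- Since e^(-2q) ≤ n^(-2a), the dimension factor n costs one power, and n^(1-2a) ≤ n^(-a) because a
≥ 1. -/
theorem two_mul_natCast_mul_exp_le {n q : ℕ} (hn : 1 ≤ n) {a : ℝ} (ha : 2 < a)
    (hq : a * Real.log n ≤ q) : 2 * n * Real.exp (-(2 * q)) ≤ 2 * (n : ℝ) ^ (-a) := by
  have hn0 : (0 : ℝ) < n := by exact_mod_cast hn
  have hlog : 0 ≤ Real.log n := Real.log_nonneg (by exact_mod_cast hn)
  rw [Real.rpow_def_of_pos hn0, mul_assoc]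
  refine mul_le_mul_of_nonneg_left ?_ zero_le_two
  nth_rewrite 1 [← Real.exp_log hn0]
  rw [← Real.exp_add]
  exact Real.exp_le_exp.2 (by nlinarith)

/-- Norms of matrices are `ℓ²` operator (spectral) norms. The constants `C` and `K` are absolute. -/
theorem mainTheorem2 :
    ∃ C K : ℝ, 0 < C ∧ 0 < K ∧
      ∀ (n m r : ℕ), 1 ≤ n → 1 ≤ m →
      ∀ (A : Matrix (Fin n) (Fin m) ℝ) (μ₁ μ₂ : ℝ), A.rank = r → IsIncoherent μ₁ μ₂ A →
      ∀ (p : ℝ), 0 < p → p ≤ 1 →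
      ∀ (Ω : Type*) [MeasurableSpace Ω] (P : Measure Ω) [IsProbabilityMeasure P]
        (W : Ω → Set (Fin n × Fin m × Fin n)), IsWedgeSample P p W →
      ∀ a : ℝ, 2 < a →
        1 - K * (n : ℝ) ^ (-a) ≤
          P.real {ω | ‖wedgeEstimator p A (W ω) - A * Aᵀ‖ ≤
            C * (√(a * μ₁ * μ₂ * r ^ 2 * Real.log n / (p * m * n)) +
              a * μ₁ * μ₂ * r ^ 2 * Real.log n / (p * m * n)) * ‖A‖ ^ 2} := by
  refine ⟨4 * Real.exp 3, 2, by positivity, by norm_num, ?_⟩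
  rintro n m _ hn hm A μ₁ μ₂ rfl hA p hp0 hp1 Ω _ P _ W hW a ha
  have hn0 : (0 : ℝ) < n := by exact_mod_cast hn
  have hm0 : (0 : ℝ) < m := by exact_mod_cast hm
  -- For n = 1 the logarithm vanishes, but K = 2 makes the claimed probability bound negative.
  rcases hn.eq_or_lt with rfl | hn2
  · have : (0 : ℝ) ≤ P.real {ω | ‖wedgeEstimator p A (W ω) - A * Aᵀ‖ ≤
      4 * Real.exp 3 * (√(a * μ₁ * μ₂ * A.rank ^ 2 * Real.log (1 : ℕ) / (p * m * (1 : ℕ))) +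
        a * μ₁ * μ₂ * A.rank ^ 2 * Real.log (1 : ℕ) / (p * m * (1 : ℕ))) * ‖A‖ ^ 2} :=
      measureReal_nonneg
    rw [Nat.cast_one, Real.one_rpow] at *
    linarith
  by_cases hA0 : A = 0
  · subst hA0
    have hZ : ∀ ω, wedgeEstimator p (0 : Matrix (Fin n) (Fin m) ℝ) (W ω) = 0 := fun ω => by
      simp [wedgeEstimator, wedgeTerm]
    have : (0 : ℝ) ≤ 2 * (n : ℝ) ^ (-a) := by positivity
    simp [hZ, this]
  set ϑ : ℝ := μ₁ * A.rank / n * (μ₂ * A.rank / m) with hϑ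
  set N : ℝ := ‖A‖ with hN
  obtain ⟨i, l, hil⟩ : ∃ i l, A i l ≠ 0 := by
    by_contra! h
    exact hA0 (Matrix.ext h)
  -- No sign is assumed on μ₁ and μ₂; positivity of ϑ is forced by a nonzero entry of A.
  have hNϑ : 0 < N ^ 2 * ϑ := lt_of_lt_of_le (by positivity) (hA.entry_sq_le i l)
  have hϑ0 : 0 < ϑ := pos_of_mul_pos_right hNϑ (sq_nonneg _)
  have hN0 : 0 < N := norm_pos_iff.2 hA0
  have hlog : Real.log 2 ≤ Real.log n := Real.log_le_log two_pos (by exact_mod_cast hn2)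
  have hlog2 := Real.log_two_gt_d9
  -- Uses a > 2 and log 2 > 1/2; it ensures that rounding a log n up to q at most doubles it.
  have hx1 : 1 ≤ a * Real.log n := by nlinarith
  set q : ℕ := ⌈a * Real.log n⌉₊ with hq
  have hq1 : a * Real.log n ≤ q := Nat.le_ceil _
  have hq2 : (q : ℝ) ≤ 2 * (a * Real.log n) := by
    have := Nat.ceil_lt_add_one (zero_le_one.trans hx1)
    linarith
  have hq0 : 0 < q := Nat.ceil_pos.2 (by linarith)
  set s : ℝ := a * μ₁ * μ₂ * A.rank ^ 2 * Real.log n / (p * m * n) with hs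
  have hs' : s = (a * Real.log n) * (p⁻¹ * ϑ) := by
    rw [hs, hϑ]
    field_simp
  have hs0 : 0 < s := by rw [hs']; positivity
  have hqs : q * (p⁻¹ * ϑ) ≤ 2 * s := by
    rw [hs', ← mul_assoc 2]
    exact mul_le_mul_of_nonneg_right hq2 (by positivity)
  have hqs0 : 0 ≤ q * (p⁻¹ * ϑ) := by positivity
  refine le_trans (sub_le_sub_left (two_mul_natCast_mul_exp_le hn ha hq1) 1) ?_
  refine hW.one_sub_le_real_norm_le hp0 hp1 (b := (p⁻¹ * (N ^ 2 * ϑ)) ^ 2)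
    (v := p⁻¹ * (2 * (N ^ 4 * ϑ))) (by positivity) (fun t u => ?_) (fun u => ?_) hq0
    (by positivity) ?_
  · rw [mul_pow, inv_pow]
    exact mul_le_mul_of_nonneg_left (hA.wedgeSqDiag_le t u) (by positivity)
  · exact mul_le_mul_of_nonneg_left (hA.sum_wedgeSqDiag_le u) (by positivity)
  · have hsq : √s ^ 2 = s := Real.sq_sqrt hs0.le
    calc 4 * Real.exp 5 * q * (p⁻¹ * (2 * (N ^ 4 * ϑ)) + q * (p⁻¹ * (N ^ 2 * ϑ)) ^ 2)
        = 4 * Real.exp 5 * N ^ 4 * (2 * (q * (p⁻¹ * ϑ)) + (q * (p⁻¹ * ϑ)) ^ 2) := by ring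
      -- The exponent 5 is raised to 6 so that 16 e⁶ is the square of C = 4e³.
      _ ≤ 4 * Real.exp 6 * N ^ 4 * (2 * (2 * s) + (2 * s) ^ 2) := by
          gcongr
          norm_num
      _ = 16 * Real.exp 6 * N ^ 4 * (√s ^ 2 + s ^ 2) := by rw [hsq]; ring
      _ ≤ 16 * Real.exp 6 * N ^ 4 * (√s + s) ^ 2 := by
          gcongr
          nlinarith [mul_nonneg (Real.sqrt_nonneg s) hs0.le]
      _ = (4 * Real.exp 3 * (√s + s) * N ^ 2) ^ 2 := by
          rw [show (6 : ℝ) = 3 + 3 by norm_num, Real.exp_add]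
          ring
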